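/- A \emph{left Ehresmann monoid}, regarded as a unary monoid, is a monoid $M$ with a unary operation $a\mapsto a^+$ satisfying the identities $$a^+a=a,\qquad a^+b^+=b^+a^+,\qquad (a^+b^+)^+=a^+b^+,\qquad (ab^+)^+=(ab)^+ .$$ For a set $X$, let $\mathrm{FLAd}(X)$ be the free left Ehresmann monoid on $X$, that is, the free object on $X$ in the variety of unary monoids defined by these identities. For a monoid $S$, a right $S$-act is \emph{finitely presented} if it is isomorphic to $F/\rho$, where $F=Y\times S$ is the free right $S$-act on a finite set $Y$, with action $(y,s)t=(y,st)$, and $\rho$ is a finitely generated congruence of right $S$-acts on $F$. The monoid $S$ is \emph{weakly right coherent} if every finitely generated right ideal of $S$ is finitely presented as a right $S$-act; \emph{weakly left coherent} is defined dually, with left ideals and left $S$-acts. \textbf{Theorem.} For every set $X$, the free left Ehresmann monoid $\mathrm{FLAd}(X)$, regarded as a monoid, is both weakly left coherent and weakly right coherent. -/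

import Mathlib

universe u v

/-! ### Acts over a monoid and weak coherence

A left act over a monoid `S` is a `MulAction S A`; a right act over `S` is a `MulAction Sᵐᵒᵖ A`, with
`MulOpposite.op s • a` standing for `a s`. Subacts are `SubMulAction`s and act congruences are
`SMulCon`s. -/

section Acts

/-- `ρ` is the act congruence generated by the set of pairs `Y`: the smallest act congruence
containing `Y`. -/
def SMulCon.IsGeneratedBy {R : Type u} {A : Type v} [SMul R A]
    (ρ : SMulCon R A) (Y : Set (A × A)) : Prop :=
  (∀ p ∈ Y, ρ.r p.1 p.2) ∧
    ∀ σ : SMulCon R A, (∀ p ∈ Y, σ.r p.1 p.2) → ∀ a b : A, ρ.r a b → σ.r a b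

/-- An act congruence is finitely generated if it is generated by a finite set of pairs. -/
def SMulCon.FinitelyGenerated {R : Type u} {A : Type v} [SMul R A] (ρ : SMulCon R A) : Prop :=
  ∃ Y : Set (A × A), Y.Finite ∧ ρ.IsGeneratedBy Y

/-- The free `R`-act of rank `n`: pairs `(i, s)` with `i < n` and `s ∈ R`, with the action
`r • (i, s) = (i, r * s)`. -/
abbrev FreeAct (R : Type u) (n : ℕ) : Type u := Σ _ : Fin n, R

/-- An `R`-act is finitely presented if it is isomorphic to a quotient of a free act of finite rank
by a finitely generated congruence. -/
def FinitelyPresentedAct (R : Type u) (A : Type v) [Monoid R] [MulAction R A] : Prop :=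
  ∃ (n : ℕ) (ρ : SMulCon R (FreeAct R n)), ρ.FinitelyGenerated ∧
    ∃ φ : A →[R] ρ.Quotient, Function.Bijective φ

/-- Every finitely generated left ideal of `S` (the empty one included) is finitely presented as a
left `S`-act. -/
def WeaklyLeftCoherent (S : Type u) [Monoid S] : Prop :=
  ∀ I : SubMulAction S S, I.FG → FinitelyPresentedAct S I

/-- Every finitely generated right ideal of `S` (the empty one included) is finitely presented as a
right `S`-act. -/
def WeaklyRightCoherent (S : Type u) [Monoid S] : Prop :=
  ∀ I : SubMulAction Sᵐᵒᵖ S, I.FG → FinitelyPresentedAct Sᵐᵒᵖ I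

end Acts

/-! ### Left Ehresmann monoids -/

/-- A left Ehresmann monoid, as a monoid with an additional unary operation `a ↦ a⁺`
satisfying identities; see `leftEhresmann_identities_iff` for the description through the relation
`RTilde E`, where `E` is the semilattice of projections. -/
class LeftEhresmannMonoid (M : Type u) extends Monoid M where
  /-- The unary operation `a ↦ a⁺`. -/
  plus : M → M
  plus_mul_self : ∀ a : M, plus a * a = a
  plus_mul_comm : ∀ a b : M, plus a * plus b = plus b * plus a
  plus_plus_mul_plus : ∀ a b : M, plus (plus a * plus b) = plus a * plus b
  plus_mul_plus : ∀ a b : M, plus (a * plus b) = plus (a * b)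

/-- `a` and `b` have the same left identities from `E`. -/
def RTilde {M : Type u} [Monoid M] (E : Set M) (a b : M) : Prop :=
  ∀ e ∈ E, e * a = a ↔ e * b = b

/-- `M` is left `E`-Ehresmann: `E` is a semilattice of idempotents, every `RTilde E`-class contains
exactly one element of `E`, and `RTilde E` is a left congruence. -/
structure IsLeftEhresmannWith {M : Type u} [Monoid M] (E : Set M) : Prop where
  idem : ∀ e ∈ E, e * e = e
  comm : ∀ e ∈ E, ∀ f ∈ E, e * f = f * e
  mul_mem : ∀ e ∈ E, ∀ f ∈ E, e * f ∈ E
  existsUnique : ∀ a : M, ∃! e : M, e ∈ E ∧ RTilde E a e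
  leftCongruence : ∀ a b c : M, RTilde E a b → RTilde E (c * a) (c * b)

/-- The identities of `LeftEhresmannMonoid` hold for a unary operation `p` on a monoid exactly if
the monoid is left `E`-Ehresmann for some `E`, with `p a` the element of `E` in the class of `a`. -/
theorem leftEhresmann_identities_iff {M : Type u} [Monoid M] (p : M → M) :
    ((∀ a, p a * a = a) ∧ (∀ a b, p a * p b = p b * p a) ∧
      (∀ a b, p (p a * p b) = p a * p b) ∧ (∀ a b, p (a * p b) = p (a * b))) ↔
    ∃ E : Set M, IsLeftEhresmannWith E ∧ ∀ a, p a ∈ E ∧ RTilde E a (p a) := by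
  constructor
  · rintro ⟨h1, h2, h3, h4⟩
    have hpp : ∀ a, p (p a) = p a := fun a => by simpa using h4 1 a
    have hid : ∀ a, p a * p a = p a := fun a => by simpa [hpp] using h1 (p a)
    have hR : ∀ a, RTilde (Set.range p) a (p a) := by
      rintro a _ ⟨b, rfl⟩
      constructor
      · intro h
        have := h4 (p b) a
        rwa [h3, h] at this
      · intro h
        rw [← h1 a, ← mul_assoc, h]
    have hEq : ∀ a b, RTilde (Set.range p) a b → p a = p b := by
      intro a b h
      have e1 : p a * p b = p b := (hR b _ ⟨a, rfl⟩).1 ((h _ ⟨a, rfl⟩).1 (h1 a))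
      have e2 : p b * p a = p a := (hR a _ ⟨b, rfl⟩).1 ((h _ ⟨b, rfl⟩).2 (h1 b))
      rw [← e2, ← h2, e1]
    have hEq' : ∀ a b, p a = p b → RTilde (Set.range p) a b := by
      intro a b h e he
      rw [hR a e he, hR b e he, h]
    refine ⟨Set.range p, ⟨?_, ?_, ?_, ?_, ?_⟩, fun a => ⟨⟨a, rfl⟩, hR a⟩⟩
    · rintro _ ⟨a, rfl⟩; exact hid a
    · rintro _ ⟨a, rfl⟩ _ ⟨b, rfl⟩; exact h2 a b
    · rintro _ ⟨a, rfl⟩ _ ⟨b, rfl⟩; exact ⟨_, h3 a b⟩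
    · intro a
      refine ⟨p a, ⟨⟨a, rfl⟩, hR a⟩, ?_⟩
      rintro _ ⟨⟨b, rfl⟩, h⟩
      rw [hEq _ _ h, hpp]
    · intro a b c h
      apply hEq'
      rw [← h4 c a, ← h4 c b, hEq a b h]
  · rintro ⟨E, hE, hp⟩
    have hid : ∀ a, p a * p a = p a := fun a => hE.idem _ (hp a).1
    have huniq : ∀ a e, e ∈ E → RTilde E a e → p a = e := fun a e he h =>
      (hE.existsUnique a).unique (hp a) ⟨he, h⟩
    refine ⟨fun a => ((hp a).2 _ (hp a).1).2 (hid a),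
      fun a b => hE.comm _ (hp a).1 _ (hp b).1, fun a b => ?_, fun a b => ?_⟩
    · exact huniq _ _ (hE.mul_mem _ (hp a).1 _ (hp b).1) fun e _ => Iff.rfl
    · refine huniq _ _ (hp _).1 fun e he => ?_
      rw [← hE.leftCongruence _ _ a (hp b).2 e he]
      exact (hp (a * b)).2 e he

/-! ### The free left Ehresmann monoid -/

/-- Terms over `X` in the signature of unary monoids. -/
inductive UnaryMonoidTerm (X : Type u) : Type u
  | of : X → UnaryMonoidTerm X
  | one : UnaryMonoidTerm X
  | mul : UnaryMonoidTerm X → UnaryMonoidTerm X → UnaryMonoidTerm X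
  | plus : UnaryMonoidTerm X → UnaryMonoidTerm X

namespace UnaryMonoidTerm

/-- The least congruence on terms for which the quotient is a left Ehresmann monoid. -/
inductive Rel {X : Type u} : UnaryMonoidTerm X → UnaryMonoidTerm X → Prop
  | refl (a) : Rel a a
  | symm {a b} : Rel a b → Rel b a
  | trans {a b c} : Rel a b → Rel b c → Rel a c
  | mul_congr {a a' b b'} : Rel a a' → Rel b b' → Rel (mul a b) (mul a' b')
  | plus_congr {a a'} : Rel a a' → Rel (plus a) (plus a')
  | mul_assoc (a b c) : Rel (mul (mul a b) c) (mul a (mul b c))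
  | one_mul (a) : Rel (mul one a) a
  | mul_one (a) : Rel (mul a one) a
  | plus_mul_self (a) : Rel (mul (plus a) a) a
  | plus_mul_comm (a b) : Rel (mul (plus a) (plus b)) (mul (plus b) (plus a))
  | plus_plus_mul_plus (a b) :
      Rel (plus (mul (plus a) (plus b))) (mul (plus a) (plus b))
  | plus_mul_plus (a b) : Rel (plus (mul a (plus b))) (plus (mul a b))

/-- `Rel` as a setoid. -/
def relSetoid (X : Type u) : Setoid (UnaryMonoidTerm X) :=
  ⟨Rel, Rel.refl, Rel.symm, Rel.trans⟩

/-- The value of a term in a left Ehresmann monoid. -/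
def eval {X : Type u} {N : Type v} [LeftEhresmannMonoid N] (f : X → N) : UnaryMonoidTerm X → N
  | of x => f x
  | one => 1
  | mul a b => eval f a * eval f b
  | plus a => LeftEhresmannMonoid.plus (eval f a)

theorem eval_eq_of_rel {X : Type u} {N : Type v} [LeftEhresmannMonoid N] (f : X → N)
    {a b : UnaryMonoidTerm X} (h : Rel a b) : eval f a = eval f b := by
  induction h with
  | refl => rfl
  | symm _ ih => exact ih.symm
  | trans _ _ ih₁ ih₂ => exact ih₁.trans ih₂
  | mul_congr _ _ ih₁ ih₂ => simp only [eval, ih₁, ih₂]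
  | plus_congr _ ih => simp only [eval, ih]
  | mul_assoc => exact _root_.mul_assoc _ _ _
  | one_mul => exact _root_.one_mul _
  | mul_one => exact _root_.mul_one _
  | plus_mul_self => exact LeftEhresmannMonoid.plus_mul_self _
  | plus_mul_comm => exact LeftEhresmannMonoid.plus_mul_comm _ _
  | plus_plus_mul_plus => exact LeftEhresmannMonoid.plus_plus_mul_plus _ _
  | plus_mul_plus => exact LeftEhresmannMonoid.plus_mul_plus _ _

end UnaryMonoidTerm

/-- The free left Ehresmann monoid on `X`: the free object on `X` in the variety of unary monoids
formed by the left Ehresmann monoids (see `FLAd.existsUnique_lift`). -/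
def FLAd (X : Type u) : Type u := Quotient (UnaryMonoidTerm.relSetoid X)

namespace FLAd

open UnaryMonoidTerm

/-- The class of a term. -/
def mk {X : Type u} (a : UnaryMonoidTerm X) : FLAd X := Quotient.mk (relSetoid X) a

instance instLeftEhresmannMonoid (X : Type u) : LeftEhresmannMonoid (FLAd X) where
  mul := Quotient.map₂ UnaryMonoidTerm.mul fun _ _ h₁ _ _ h₂ => Rel.mul_congr h₁ h₂
  one := Quotient.mk (relSetoid X) UnaryMonoidTerm.one
  plus := Quotient.map UnaryMonoidTerm.plus fun _ _ h => Rel.plus_congr h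
  mul_assoc := by
    rintro ⟨a⟩ ⟨b⟩ ⟨c⟩; exact Quotient.sound (s := relSetoid X) (Rel.mul_assoc a b c)
  one_mul := by rintro ⟨a⟩; exact Quotient.sound (s := relSetoid X) (Rel.one_mul a)
  mul_one := by rintro ⟨a⟩; exact Quotient.sound (s := relSetoid X) (Rel.mul_one a)
  plus_mul_self := by rintro ⟨a⟩; exact Quotient.sound (s := relSetoid X) (Rel.plus_mul_self a)
  plus_mul_comm := by
    rintro ⟨a⟩ ⟨b⟩; exact Quotient.sound (s := relSetoid X) (Rel.plus_mul_comm a b)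
  plus_plus_mul_plus := by
    rintro ⟨a⟩ ⟨b⟩; exact Quotient.sound (s := relSetoid X) (Rel.plus_plus_mul_plus a b)
  plus_mul_plus := by
    rintro ⟨a⟩ ⟨b⟩; exact Quotient.sound (s := relSetoid X) (Rel.plus_mul_plus a b)

/-- The canonical map from `X` to the free left Ehresmann monoid. -/
def of {X : Type u} (x : X) : FLAd X := mk (UnaryMonoidTerm.of x)

/-- The universal property of the free left Ehresmann monoid. -/
theorem existsUnique_lift {X : Type u} {N : Type v} [LeftEhresmannMonoid N] (f : X → N) :
    ∃! φ : FLAd X →* N,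
      (∀ a, φ (LeftEhresmannMonoid.plus a) = LeftEhresmannMonoid.plus (φ a)) ∧
        ∀ x, φ (of x) = f x := by
  refine ⟨⟨⟨Quotient.lift (eval f) fun _ _ h => eval_eq_of_rel f h, rfl⟩, ?_⟩, ⟨?_, ?_⟩, ?_⟩
  · rintro ⟨a⟩ ⟨b⟩; rfl
  · rintro ⟨a⟩; rfl
  · intro x; rfl
  · rintro ψ ⟨h₁, h₂⟩
    ext a
    induction a using Quotient.inductionOn with | _ a => ?_
    change ψ (mk a) = eval f a
    induction a with
    | of x => exact h₂ x
    | one => exact map_one ψ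
    | mul a b iha ihb =>
      exact (map_mul ψ (mk a) (mk b)).trans (congrArg₂ (· * ·) iha ihb)
    | plus a iha => exact (h₁ (mk a)).trans (congrArg LeftEhresmannMonoid.plus iha)

end FLAd

/-! Both coherence properties reduce to statements about one or two elements: annihilators generated
by a pair `(1, e)`, and cyclic subacts meeting in an empty or cyclic subact
(`finitelyPresentedAct_of_principal`). These are checked on normal forms f₀x₁f₁…xₙfₙ with
projections satisfying fᵢ₋₁ ≤ (xᵢfᵢ)⁺ (`NormalChain.exists_mulEquiv`).

Annihilators: letters match up in any equation of products, so au = av reduces to fₙu = fₙv for the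
final projection fₙ of a, and ua = va reduces to ua⁺ = va⁺.

Intersections: let a be no longer than b. If ua = vb, then either b ∈ Sa, and Sb is the
intersection, or a and b differ only in their heads, and b⁺a = a⁺b generates it
(`right_factor_or_of_mul_eq`). On the other side, whether bv ∈ aS depends only on v⁺, and the
admissible projections, if any, are those below some q (`emptyOrPrincipal_isPrefix_mul`); then bq
generates aS ∩ bS. This last point rests on (xe)⁺ being meet-prime among projections
(`inf_le_op_iff`). -/

/-! ### A criterion for weak coherence

If all annihilator congruences of elements of an act are generated by a single pair `(1, e)`, and
all intersections of two cyclic subacts are empty or cyclic, then the finitely generated subacts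
are finitely presented. -/

section Criterion

variable {R : Type u} {A : Type v} [Monoid R] [MulAction R A]

/-- The annihilator congruence of each element is generated by a pair `(1, e)`. -/
def PrincipalAnnihilators (R : Type u) (A : Type v) [Monoid R] [MulAction R A] : Prop :=
  ∀ a : A, ∃ e : R, e • a = a ∧ ∀ u v : R, u • a = v • a → u * e = v * e

/-- The intersection of two cyclic subacts is empty or cyclic. -/
def PrincipalIntersections (R : Type u) (A : Type v) [Monoid R] [MulAction R A] : Prop :=
  ∀ a b : A, (∃ u v : R, u • a = v • b) →
    ∃ p q : R, p • a = q • b ∧ ∀ u v : R, u • a = v • b → ∃ t : R, u • a = t • p • a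

/-- The congruence on the free act identifying the elements with equal images under
`(i, s) ↦ s • a i`. -/
def evalCon {n : ℕ} (a : Fin n → A) : SMulCon R (FreeAct R n) where
  r x y := x.2 • a x.1 = y.2 • a y.1
  iseqv := ⟨fun _ => rfl, fun h => h.symm, fun h h' => h.trans h'⟩
  smul := by
    rintro r ⟨i, s⟩ ⟨j, t⟩ h
    change (r * s) • a i = (r * t) • a j
    rw [mul_smul, mul_smul]
    exact congrArg (r • ·) h

/-- One pair per generator and one per intersecting pair of generators suffice: (i, u) ~ (i, u eᵢ) =
(i, t p eᵢ) ~ (i, t p) ~ (j, t q) ~ (j, t q eⱼ) = (j, v eⱼ) ~ (j, v). -/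
theorem evalCon_finitelyGenerated (h₁ : PrincipalAnnihilators R A)
    (h₂ : PrincipalIntersections R A) {n : ℕ} (a : Fin n → A) :
    (evalCon (R := R) a).FinitelyGenerated := by
  classical
  choose e he he' using fun i => h₁ (a i)
  have h₃ : ∀ i j, ∃ p q : R, (∃ u v : R, u • a i = v • a j) → p • a i = q • a j ∧
      ∀ u v : R, u • a i = v • a j → ∃ t : R, u • a i = t • p • a i := fun i j => by
    by_cases h : ∃ u v : R, u • a i = v • a j
    · obtain ⟨p, q, h'⟩ := h₂ _ _ h; exact ⟨p, q, fun _ => h'⟩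
    -- Junk values: disjoint pairs are left out of `Y₂`.
    · exact ⟨1, 1, fun h' => (h h').elim⟩
  choose p q hpq using h₃
  let Y₁ : Set (FreeAct R n × FreeAct R n) := Set.range fun i => (⟨i, 1⟩, ⟨i, e i⟩)
  let Y₂ : Set (FreeAct R n × FreeAct R n) :=
    (fun ij : Fin n × Fin n => (⟨ij.1, p ij.1 ij.2⟩, ⟨ij.2, q ij.1 ij.2⟩)) ''
      {ij | ∃ u v : R, u • a ij.1 = v • a ij.2}
  refine ⟨Y₁ ∪ Y₂, (Set.finite_range _).union ((Set.toFinite _).image _), ?_, ?_⟩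
  · rintro _ (⟨i, rfl⟩ | ⟨⟨i, j⟩, h, rfl⟩)
    · change (1 : R) • a i = e i • a i
      rw [one_smul, he]
    · exact (hpq i j h).1
  · rintro σ hσ ⟨i, u⟩ ⟨j, v⟩ (h : u • a i = v • a j)
    have hE : ∀ i (s : R), σ.r ⟨i, s⟩ ⟨i, s * e i⟩ := fun i s => by
      have := σ.smul s (hσ _ (Or.inl ⟨i, rfl⟩))
      simpa using this
    obtain ⟨hp, ht⟩ := hpq i j ⟨u, v, h⟩
    obtain ⟨t, ht⟩ := ht u v h
    have e₁ : u * e i = t * p i j * e i := he' i _ _ (by rw [ht, mul_smul])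
    have e₂ : v * e j = t * q i j * e j := he' j _ _ (by rw [← h, ht, mul_smul, hp])
    have hσ' : σ.r ⟨i, t * p i j⟩ ⟨j, t * q i j⟩ :=
      σ.smul t (hσ _ (Or.inr ⟨(i, j), ⟨u, v, h⟩, rfl⟩))
    have s₁ := hE i u
    rw [e₁] at s₁
    have s₂ := hE j v
    rw [e₂] at s₂
    exact σ.iseqv.trans s₁ <| σ.iseqv.trans (σ.iseqv.symm (hE i _)) <|
      σ.iseqv.trans hσ' <| σ.iseqv.trans (hE j _) (σ.iseqv.symm s₂)

theorem finitelyPresentedAct_of_principal (h₁ : PrincipalAnnihilators R A)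
    (h₂ : PrincipalIntersections R A) (I : SubMulAction R A) (hI : I.FG) :
    FinitelyPresentedAct R I := by
  obtain ⟨s, rfl⟩ := SubMulAction.fg_iff.1 hI
  let a : Fin s.card → A := fun i => (s.equivFin.symm i : A)
  have ha : ∀ x : SubMulAction.closure R (s : Set A), ∃ y : FreeAct R s.card, y.2 • a y.1 = x := by
    let J : SubMulAction R A :=
      { carrier := {x | ∃ y : FreeAct R s.card, y.2 • a y.1 = x}
        smul_mem' := by
          rintro r _ ⟨⟨i, t⟩, rfl⟩
          exact ⟨⟨i, r * t⟩, mul_smul r t (a i)⟩ }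
    have hJ : SubMulAction.closure R (s : Set A) ≤ J := SubMulAction.closure_le.2 fun x hx =>
      ⟨⟨s.equivFin ⟨x, hx⟩, 1⟩, by simp [a]⟩
    exact fun x => hJ x.2
  have ha' : ∀ i, a i ∈ SubMulAction.closure R (s : Set A) := fun i =>
    SubMulAction.subset_closure (s.equivFin.symm i).2
  choose f hf using ha
  let ρ := evalCon (R := R) a
  let π : FreeAct R s.card → ρ.Quotient := Quotient.mk ρ.toSetoid
  have hρ : ∀ x y : FreeAct R s.card, π x = π y ↔ x.2 • a x.1 = y.2 • a y.1 :=
    fun x y => Quotient.eq (r := ρ.toSetoid)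
  refine ⟨_, ρ, evalCon_finitelyGenerated h₁ h₂ a, ⟨fun x => π (f x), ?_⟩, ?_, ?_⟩
  · intro r x
    refine (hρ (f (r • x)) (r • f x)).2 ?_
    rw [hf]
    change r • (x : A) = (r * (f x).2) • a (f x).1
    rw [mul_smul, hf]
  · intro x y h
    have := (hρ _ _).1 h
    rw [hf, hf] at this
    exact Subtype.ext this
  · intro z
    obtain ⟨y, rfl⟩ := Quotient.exists_rep z
    refine ⟨⟨y.2 • a y.1, SubMulAction.smul_mem _ _ (ha' _)⟩, (hρ _ _).2 ?_⟩
    rw [hf]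

end Criterion

/-! ### The semilattice of projections -/

/-- Terms for the elements of the free semilattice with a top element and one monotone operation
for each letter. -/
inductive ProjTerm (X : Type u) : Type u
  | top : ProjTerm X
  | meet : ProjTerm X → ProjTerm X → ProjTerm X
  | op : X → ProjTerm X → ProjTerm X

namespace ProjTerm

variable {X : Type u}

/-- Some branch of the term at its root is labelled `x` and leads to a term satisfying `P`. -/
def HasBranch (x : X) (P : ProjTerm X → Prop) : ProjTerm X → Prop
  | top => False
  | meet a b => HasBranch x P a ∨ HasBranch x P b
  | op y a => y = x ∧ P a

/-- `Below f e` is the order relation `e ≤ f`. -/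
def Below : ProjTerm X → ProjTerm X → Prop
  | top => fun _ => True
  | meet f g => fun e => Below f e ∧ Below g e
  | op x f => HasBranch x (Below f)

theorem HasBranch.mono {x : X} {P Q : ProjTerm X → Prop} (h : ∀ e, P e → Q e) :
    ∀ {e}, HasBranch x P e → HasBranch x Q e
  | meet _ _, h' => h'.imp (HasBranch.mono h) (HasBranch.mono h)
  | op _ _, h' => ⟨h'.1, h _ h'.2⟩

theorem Below.trans : ∀ {g f e : ProjTerm X}, Below g f → Below f e → Below g e
  | top, _, _, _, _ => trivial
  | meet _ _, _, _, h, h' => ⟨h.1.trans h', h.2.trans h'⟩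
  | op _ _, meet _ _, _, h, h' => h.elim (fun h => Below.trans h h'.1) (fun h => Below.trans h h'.2)
  | op _ _, op _ _, _, h, h' => by
    obtain ⟨rfl, h⟩ := h
    exact HasBranch.mono (fun _ => h.trans) h'

theorem Below.meet_left : ∀ {g f : ProjTerm X} (e : ProjTerm X), Below g f → Below g (meet f e)
  | top, _, _, _ => trivial
  | meet _ _, _, _, h => ⟨h.1.meet_left _, h.2.meet_left _⟩
  | op _ _, _, _, h => Or.inl h

theorem Below.meet_right : ∀ {g f : ProjTerm X} (e : ProjTerm X), Below g f → Below g (meet e f)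
  | top, _, _, _ => trivial
  | meet _ _, _, _, h => ⟨h.1.meet_right _, h.2.meet_right _⟩
  | op _ _, _, _, h => Or.inr h

theorem Below.refl : ∀ e : ProjTerm X, Below e e
  | top => trivial
  | meet a b => ⟨(Below.refl a).meet_left b, (Below.refl b).meet_right a⟩
  | op _ a => ⟨rfl, Below.refl a⟩

instance : Preorder (ProjTerm X) where
  le e f := Below f e
  le_refl := Below.refl
  le_trans _ _ _ h h' := h'.trans h

end ProjTerm

/-- The free semilattice with a top element and one monotone operation for each letter. -/
def Proj (X : Type u) : Type u := Antisymmetrization (ProjTerm X) (· ≤ ·)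

namespace Proj

open ProjTerm

variable {X : Type u}

/-- The class of a term. -/
def mk (e : ProjTerm X) : Proj X := toAntisymmetrization (· ≤ ·) e

instance : PartialOrder (Proj X) :=
  inferInstanceAs (PartialOrder (Antisymmetrization (ProjTerm X) (· ≤ ·)))

instance : SemilatticeInf (Proj X) where
  inf := Quotient.map₂ ProjTerm.meet fun _ _ h₁ _ _ h₂ =>
    ⟨⟨Below.meet_left _ h₁.1, Below.meet_right _ h₂.1⟩,
      ⟨Below.meet_left _ h₁.2, Below.meet_right _ h₂.2⟩⟩
  inf_le_left := by rintro ⟨a⟩ ⟨b⟩; exact (Below.refl a).meet_left b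
  inf_le_right := by rintro ⟨a⟩ ⟨b⟩; exact (Below.refl b).meet_right a
  le_inf := by rintro ⟨a⟩ ⟨b⟩ ⟨c⟩ h h'; exact ⟨h, h'⟩

instance : OrderTop (Proj X) where
  top := mk top
  le_top := by rintro ⟨a⟩; trivial

/-- The operation of a letter; it corresponds to `e ↦ (x e)⁺`. -/
def op (x : X) : Proj X → Proj X :=
  Quotient.map (ProjTerm.op x) fun _ _ h => ⟨⟨rfl, h.1⟩, ⟨rfl, h.2⟩⟩

theorem op_le_op_iff {x y : X} {e f : Proj X} : op x e ≤ op y f ↔ x = y ∧ e ≤ f := by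
  induction e using Quotient.inductionOn
  induction f using Quotient.inductionOn
  exact Iff.rfl

theorem op_mono (x : X) {e f : Proj X} (h : e ≤ f) : op x e ≤ op x f := op_le_op_iff.2 ⟨rfl, h⟩

/-- Meet-primeness is built into `HasBranch`: a branch of a meet lies in one of its two factors. -/
theorem inf_le_op_iff {x : X} {e f g : Proj X} : e ⊓ f ≤ op x g ↔ e ≤ op x g ∨ f ≤ op x g := by
  induction e using Quotient.inductionOn
  induction f using Quotient.inductionOn
  induction g using Quotient.inductionOn
  exact Iff.rfl

@[elab_as_elim]
theorem induction {P : Proj X → Prop} (top : P ⊤) (inf : ∀ e f, P e → P f → P (e ⊓ f))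
    (op : ∀ x e, P e → P (op x e)) (e : Proj X) : P e := by
  induction e using Quotient.inductionOn with | _ e => ?_
  induction e with
  | top => exact top
  | meet a b iha ihb => exact inf _ _ iha ihb
  | op x a ih => exact op x _ ih

/-- A set of projections that is empty or a principal ideal. -/
def EmptyOrPrincipal (P : Proj X → Prop) : Prop := (∀ h, ¬ P h) ∨ ∃ q, ∀ h, P h ↔ h ≤ q

theorem EmptyOrPrincipal.and {P Q : Proj X → Prop} (hP : EmptyOrPrincipal P)
    (hQ : EmptyOrPrincipal Q) : EmptyOrPrincipal fun h => P h ∧ Q h := by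
  obtain hP | ⟨p, hP⟩ := hP
  · exact Or.inl fun h h' => hP h h'.1
  obtain hQ | ⟨q, hQ⟩ := hQ
  · exact Or.inl fun h h' => hQ h h'.2
  · exact Or.inr ⟨p ⊓ q, fun h => by simp only [hP, hQ, le_inf_iff]⟩

theorem EmptyOrPrincipal.const_or (c : Prop) {P : Proj X → Prop} (hP : EmptyOrPrincipal P) :
    EmptyOrPrincipal fun h => c ∨ P h := by
  by_cases hc : c
  · exact Or.inr ⟨⊤, fun h => by simp [hc]⟩
  · simpa [hc] using hP

theorem EmptyOrPrincipal.const_and (c : Prop) {P : Proj X → Prop} (hP : EmptyOrPrincipal P) :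
    EmptyOrPrincipal fun h => c ∧ P h := by
  by_cases hc : c
  · simpa [hc] using hP
  · exact Or.inl fun h => by simp [hc]

end Proj

/-! ### Chains: normal forms of elements of the free left Ehresmann monoid -/

/-- Sequences `(f₀, x₁, f₁, …, xₙ, fₙ)` alternating between projections and letters. -/
inductive Chain (X : Type u) : Type u
  | last : Proj X → Chain X
  | cons : Proj X → X → Chain X → Chain X

namespace Chain

open Proj

variable {X : Type u}

/-- The first projection of a chain. -/
def head : Chain X → Proj X
  | last f => f
  | cons f _ _ => f

/-- The number of letters of a chain. -/
def length : Chain X → ℕ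
  | last _ => 0
  | cons _ _ m => m.length + 1

/-- The final projection of a chain. -/
def final : Chain X → Proj X
  | last f => f
  | cons _ _ m => m.final

/-- Meet of the first projection with `f`. -/
def scale (f : Proj X) : Chain X → Chain X
  | last g => last (f ⊓ g)
  | cons g x m => cons (f ⊓ g) x m

/-- Product of chains. -/
def mul : Chain X → Chain X → Chain X
  | last f, n => scale f n
  | cons f x m, n => cons (f ⊓ op x (m.mul n).head) x (m.mul n)

/-- `f_{i-1} ≤ (x_i f_i)⁺` holds throughout the chain. -/
def IsNormal : Chain X → Prop
  | last _ => True
  | cons f x m => f ≤ op x m.head ∧ m.IsNormal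

@[simp] theorem head_last (f : Proj X) : (last f).head = f := rfl

@[simp] theorem head_cons (f : Proj X) (x : X) (m : Chain X) : (cons f x m).head = f := rfl

@[simp] theorem scale_last (f g : Proj X) : scale f (last g) = last (f ⊓ g) := rfl

@[simp] theorem scale_cons (f g : Proj X) (x : X) (m : Chain X) :
    scale f (cons g x m) = cons (f ⊓ g) x m := rfl

@[simp] theorem last_mul (f : Proj X) (n : Chain X) : (last f).mul n = scale f n := rfl

@[simp] theorem cons_mul (f : Proj X) (x : X) (m n : Chain X) :
    (cons f x m).mul n = cons (f ⊓ op x (m.mul n).head) x (m.mul n) := rfl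

@[simp] theorem head_scale (f : Proj X) (m : Chain X) : (scale f m).head = f ⊓ m.head := by
  cases m <;> rfl

@[simp] theorem length_scale (f : Proj X) (m : Chain X) : (scale f m).length = m.length := by
  cases m <;> rfl

theorem scale_scale (f g : Proj X) (m : Chain X) : scale f (scale g m) = scale (f ⊓ g) m := by
  cases m <;> simp [inf_assoc]

theorem scale_of_head_le {f : Proj X} {m : Chain X} (h : m.head ≤ f) : scale f m = m := by
  cases m <;> simpa using h

theorem IsNormal.scale {m : Chain X} (f : Proj X) (h : m.IsNormal) : (scale f m).IsNormal := by
  cases m with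
  | last => trivial
  | cons => exact ⟨inf_le_right.trans h.1, h.2⟩

theorem IsNormal.mul (m : Chain X) {n : Chain X} (hn : n.IsNormal) : (m.mul n).IsNormal := by
  induction m with
  | last f => exact hn.scale f
  | cons f x m ih => exact ⟨inf_le_right, ih⟩

@[simp] theorem length_mul (m n : Chain X) : (m.mul n).length = m.length + n.length := by
  induction m with
  | last f => simp [length]
  | cons f x m ih => simp [length, ih]; omega

theorem head_mul_le (m n : Chain X) : (m.mul n).head ≤ m.head := by
  cases m with
  | last f => simp
  | cons f x m => exact inf_le_left

theorem scale_mul (f : Proj X) (m n : Chain X) : (scale f m).mul n = scale f (m.mul n) := by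
  cases m with
  | last g => simp [scale_scale]
  | cons g x m => simp [inf_assoc]

theorem mul_assoc (m n k : Chain X) : (m.mul n).mul k = m.mul (n.mul k) := by
  induction m with
  | last f => exact scale_mul f n k
  | cons f x m ih =>
    -- Bracketing to the left leaves an extra factor in the head, which this inequality absorbs.
    have h : op x (m.mul (n.mul k)).head ≤ op x (m.mul n).head :=
      op_mono x (ih ▸ head_mul_le (m.mul n) k)
    simp [ih, inf_assoc, inf_eq_right.2 h]

theorem mul_last_of_final_le {m : Chain X} (hm : m.IsNormal) {f : Proj X} (hf : m.final ≤ f) :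
    m.mul (last f) = m := by
  induction m with
  | last g => simpa [final] using hf
  | cons g x m ih => simp [ih hm.2 hf, hm.1]

/-- The head of `m n` depends on `n` only through its head. -/
theorem head_mul_last_head (m n : Chain X) : (m.mul (last n.head)).head = (m.mul n).head := by
  induction m with
  | last f => simp
  | cons f x m ih => simp [ih]

end Chain

/-- Normal chains. They form a left Ehresmann monoid, which turns out to be free. -/
def NormalChain (X : Type u) : Type u := {m : Chain X // m.IsNormal}

namespace NormalChain

open Proj Chain

variable {X : Type u}

/-- A projection as a chain without letters. -/
def ofProj (f : Proj X) : NormalChain X := ⟨last f, trivial⟩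

/-- The generator of the monoid of normal chains given by a letter. -/
def of (x : X) : NormalChain X := ⟨cons (op x ⊤) x (last ⊤), le_rfl, trivial⟩

instance : LeftEhresmannMonoid (NormalChain X) where
  mul m n := ⟨m.1.mul n.1, n.2.mul m.1⟩
  one := ofProj ⊤
  mul_assoc m n k := Subtype.ext (Chain.mul_assoc m.1 n.1 k.1)
  one_mul m := Subtype.ext (scale_of_head_le le_top)
  mul_one m := Subtype.ext (mul_last_of_final_le m.2 le_top)
  plus m := ofProj m.1.head
  plus_mul_self m := Subtype.ext (scale_of_head_le le_rfl)
  plus_mul_comm m n := congrArg ofProj (inf_comm _ _)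
  plus_plus_mul_plus m n := rfl
  plus_mul_plus m n := congrArg ofProj (head_mul_last_head m.1 n.1)

theorem val_mul (m n : NormalChain X) : (m * n).1 = m.1.mul n.1 := rfl

theorem ofProj_inf (f g : Proj X) : ofProj (f ⊓ g) = ofProj f * ofProj g := rfl

theorem ofProj_op (x : X) (f : Proj X) :
    ofProj (op x f) = LeftEhresmannMonoid.plus (of x * ofProj f) := by
  refine congrArg ofProj (Eq.symm ?_)
  change op x ⊤ ⊓ op x (⊤ ⊓ f) = op x f
  simp [op_mono x (le_top : f ≤ ⊤)]

theorem mk_cons (f : Proj X) (x : X) (m : Chain X) (h : (cons f x m).IsNormal) :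
    (⟨cons f x m, h⟩ : NormalChain X) = ofProj f * of x * ⟨m, h.2⟩ := by
  apply Subtype.ext
  change cons f x m = cons ((f ⊓ op x ⊤) ⊓ op x (scale ⊤ m).head) x (scale ⊤ m)
  rw [scale_of_head_le le_top, inf_assoc, inf_eq_right.2 (op_mono x le_top), inf_eq_left.2 h.1]

end NormalChain

/-! ### The monoid of normal chains is the free left Ehresmann monoid -/

namespace LeftEhresmannMonoid

variable {M : Type u} [LeftEhresmannMonoid M]

theorem plus_plus (a : M) : plus (plus a) = plus a := by
  simpa using plus_mul_plus 1 a

theorem plus_mul_of_plus_eq {e : M} (he : plus e = e) (a : M) : plus (e * a) = e * plus a := by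
  rw [← plus_mul_plus, ← he, plus_plus_mul_plus]

end LeftEhresmannMonoid

namespace ProjTerm

open LeftEhresmannMonoid

variable {X : Type u}

/-- The projection of the free left Ehresmann monoid described by a term. -/
def toFLAd : ProjTerm X → FLAd X
  | top => 1
  | meet a b => toFLAd a * toFLAd b
  | op x a => plus (FLAd.of x * toFLAd a)

theorem plus_toFLAd : ∀ e : ProjTerm X, plus (toFLAd e) = toFLAd e
  | top => by simpa [toFLAd] using plus_mul_self (1 : FLAd X)
  | meet a b => by
    rw [toFLAd, plus_mul_of_plus_eq (plus_toFLAd a), plus_toFLAd b]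
  | op x a => plus_plus _

theorem toFLAd_comm (e f : ProjTerm X) : toFLAd e * toFLAd f = toFLAd f * toFLAd e := by
  rw [← plus_toFLAd e, ← plus_toFLAd f, plus_mul_comm]

/-- Monotonicity of e ↦ (xe)⁺ carries the argument. The predicate `P` stands for `Below f`, so that
this recursion runs on `e` alone and the next one on `f`. -/
theorem toFLAd_mul_of_hasBranch {x : X} {P : ProjTerm X → Prop} {f : FLAd X}
    (hf : plus f = f) (hP : ∀ e, P e → toFLAd e * f = toFLAd e) :
    ∀ {e : ProjTerm X}, HasBranch x P e → toFLAd e * plus (FLAd.of x * f) = toFLAd e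
  | meet a b, h => by
    rcases h with h | h
    · rw [toFLAd, toFLAd_comm, mul_assoc, toFLAd_mul_of_hasBranch hf hP h]
    · rw [toFLAd, mul_assoc, toFLAd_mul_of_hasBranch hf hP h]
  | op y a, h => by
    obtain ⟨rfl, h⟩ := h
    have h' : plus (FLAd.of y * f) * (FLAd.of y * toFLAd a) = FLAd.of y * toFLAd a := by
      rw [← hP a h, ← plus_toFLAd a, ← hf, plus_mul_comm, ← mul_assoc (FLAd.of y), hf,
        ← mul_assoc, plus_mul_self]
    rw [toFLAd, plus_mul_comm, ← plus_mul_of_plus_eq (plus_plus _), h']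

theorem toFLAd_mul_of_below : ∀ {f e : ProjTerm X}, Below f e → toFLAd e * toFLAd f = toFLAd e
  | top, _, _ => mul_one _
  | meet a b, _, h => by
    rw [toFLAd, ← mul_assoc, toFLAd_mul_of_below h.1, toFLAd_mul_of_below h.2]
  | op _ f, _, h =>
    toFLAd_mul_of_hasBranch (plus_toFLAd f) (fun _ h' => toFLAd_mul_of_below h') h

end ProjTerm

/-- The embedding of projections into the free left Ehresmann monoid. -/
def Proj.toFLAd {X : Type u} : Proj X → FLAd X :=
  Quotient.lift ProjTerm.toFLAd fun e f h => by
    rw [← ProjTerm.toFLAd_mul_of_below h.1, ProjTerm.toFLAd_comm,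
      ProjTerm.toFLAd_mul_of_below h.2]

namespace Proj

open LeftEhresmannMonoid

variable {X : Type u}

theorem plus_toFLAd (e : Proj X) : plus e.toFLAd = e.toFLAd := by
  induction e using Quotient.inductionOn
  exact ProjTerm.plus_toFLAd _

theorem toFLAd_inf (e f : Proj X) : (e ⊓ f).toFLAd = e.toFLAd * f.toFLAd := by
  induction e using Quotient.inductionOn
  induction f using Quotient.inductionOn
  rfl

theorem toFLAd_op (x : X) (e : Proj X) : (op x e).toFLAd = plus (FLAd.of x * e.toFLAd) := by
  induction e using Quotient.inductionOn
  rfl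

end Proj

namespace Chain

open LeftEhresmannMonoid Proj

variable {X : Type u}

/-- The product in the free left Ehresmann monoid of the terms of a chain. -/
def toFLAd : Chain X → FLAd X
  | last f => f.toFLAd
  | cons f x m => f.toFLAd * (FLAd.of x * toFLAd m)

theorem plus_toFLAd : ∀ {m : Chain X}, m.IsNormal → plus m.toFLAd = m.head.toFLAd
  | last f, _ => f.plus_toFLAd
  | cons f x m, h => by
    rw [toFLAd, plus_mul_of_plus_eq f.plus_toFLAd, ← plus_mul_plus, plus_toFLAd h.2, ← toFLAd_op,
      ← toFLAd_inf, inf_eq_left.2 h.1, head_cons]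

theorem toFLAd_scale (f : Proj X) : ∀ m : Chain X, (scale f m).toFLAd = f.toFLAd * m.toFLAd
  | last g => toFLAd_inf f g
  | cons g x m => by simp only [scale_cons, toFLAd, toFLAd_inf, _root_.mul_assoc]

theorem toFLAd_mul (m : Chain X) {n : Chain X} (hn : n.IsNormal) :
    (m.mul n).toFLAd = m.toFLAd * n.toFLAd := by
  induction m with
  | last f => exact toFLAd_scale f n
  | cons f x m ih =>
    -- The factor added to the head is (x·mn)⁺, which is absorbed by the x·mn following it.
    rw [cons_mul, toFLAd, toFLAd_inf, toFLAd_op, ← plus_toFLAd (hn.mul m), plus_mul_plus,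
      _root_.mul_assoc, plus_mul_self, ih, toFLAd]
    simp only [_root_.mul_assoc]

end Chain

namespace NormalChain

open LeftEhresmannMonoid Proj

variable {X : Type u}

/-- The homomorphism from normal chains to the free left Ehresmann monoid. -/
def toFLAd : NormalChain X →* FLAd X where
  toFun m := m.1.toFLAd
  map_one' := rfl
  map_mul' m n := m.1.toFLAd_mul n.2

theorem toFLAd_plus (m : NormalChain X) : toFLAd (plus m) = plus (toFLAd m) :=
  (Chain.plus_toFLAd m.2).symm

theorem toFLAd_of (x : X) : toFLAd (of x) = FLAd.of x := by
  change (op x ⊤).toFLAd * (FLAd.of x * 1) = _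
  rw [toFLAd_op]
  exact plus_mul_self (FLAd.of x * 1) |>.trans (mul_one _)

/-- The free left Ehresmann monoid is isomorphic to the monoid of normal chains. -/
theorem exists_mulEquiv (X : Type u) : Nonempty (FLAd X ≃* NormalChain X) := by
  obtain ⟨φ, ⟨hφ, hφ'⟩, -⟩ := FLAd.existsUnique_lift (of : X → NormalChain X)
  -- Uniqueness in the universal property makes `φ` injective; it is surjective because letters and
  -- projections generate the normal chains.
  have h₁ : toFLAd.comp φ = MonoidHom.id (FLAd X) :=
    (FLAd.existsUnique_lift (FLAd.of : X → FLAd X)).unique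
      ⟨fun a => by simp [hφ, toFLAd_plus], fun x => by simp [hφ', toFLAd_of]⟩
      ⟨fun _ => rfl, fun _ => rfl⟩
  have h₂ : ∀ f : Proj X, ∃ a, φ a = ofProj f := fun f => by
    induction f using Proj.induction with
    | top => exact ⟨1, map_one φ⟩
    | inf e f he hf =>
      obtain ⟨⟨a, ha⟩, b, hb⟩ := And.intro he hf
      exact ⟨a * b, by rw [map_mul, ha, hb, ofProj_inf]⟩
    | op x e he =>
      obtain ⟨a, ha⟩ := he
      exact ⟨plus (FLAd.of x * a), by rw [hφ, map_mul, hφ', ha, ofProj_op]⟩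
  have h₃ : Function.Surjective φ := by
    rintro ⟨m, hm⟩
    induction m with
    | last f => exact h₂ f
    | cons f x m ih =>
      obtain ⟨⟨a, ha⟩, b, hb⟩ := And.intro (h₂ f) (ih hm.2)
      exact ⟨a * FLAd.of x * b, by rw [map_mul, map_mul, ha, hb, hφ', mk_cons f x m hm]; rfl⟩
  exact ⟨MulEquiv.ofBijective φ
    ⟨Function.LeftInverse.injective (g := toFLAd) fun a => DFunLike.congr_fun h₁ a, h₃⟩⟩

end NormalChain

/-! ### Annihilators and intersections of principal ideals of normal chains -/

namespace Chain

open Proj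

variable {X : Type u}

theorem last_final_mul_eq {a u v : Chain X} (h : a.mul u = a.mul v) :
    (last a.final).mul u = (last a.final).mul v := by
  induction a with
  | last f => exact h
  | cons f x a ih => exact ih (Chain.cons.inj h).2.2

/-- Equal lengths of the products force `u` and `v` to have equally many letters, and the
projections at the positions of `u` see `a` only through its head. -/
theorem mul_last_head_eq {a : Chain X} : ∀ {u v : Chain X}, u.mul a = v.mul a →
    u.mul (last a.head) = v.mul (last a.head)
  | last f, last g, h => by simpa using congrArg head h
  | last f, cons g y v, h => by
    have := congrArg length h
    simp [length] at this
    omega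
  | cons f x u, last g, h => by
    have := congrArg length h
    simp [length] at this
    omega
  | cons f x u, cons g y v, h => by
    simp only [cons_mul, cons.injEq] at h
    obtain ⟨h₁, rfl, h₂⟩ := h
    rw [cons_mul, cons_mul, head_mul_last_head, head_mul_last_head, h₁, mul_last_head_eq h₂]

/-- `a` divides the normal chain `c` on the left. -/
def IsPrefix : Chain X → Chain X → Prop
  | last f, c => c.head ≤ f
  | cons _ _ _, last _ => False
  | cons f x a, cons g y c => (x = y ∧ g = f ⊓ op x c.head) ∧ IsPrefix a c

theorem isPrefix_mul : ∀ a u : Chain X, IsPrefix a (a.mul u)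
  | last f, u => by simp [IsPrefix]
  | cons f x a, u => ⟨⟨rfl, rfl⟩, isPrefix_mul a u⟩

theorem IsPrefix.exists_mul_eq : ∀ {a c : Chain X}, IsPrefix a c → c.IsNormal →
    ∃ u : Chain X, u.IsNormal ∧ a.mul u = c
  | last _, c, h, hc => ⟨c, hc, scale_of_head_le h⟩
  | cons f x a, cons g y c, h, hc => by
    obtain ⟨⟨rfl, h⟩, h'⟩ := h
    obtain ⟨u, hu, rfl⟩ := h'.exists_mul_eq hc.2
    exact ⟨u, hu, by rw [cons_mul, h]⟩

/-- Since `a` runs out of letters no later than `b`, the comparison never reaches the letters of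
`v`. -/
theorem isPrefix_mul_last_head_iff (v : Chain X) : ∀ {a b : Chain X}, a.length ≤ b.length →
    (IsPrefix a (b.mul (last v.head)) ↔ IsPrefix a (b.mul v))
  | last f, b, _ => by rw [IsPrefix, IsPrefix, head_mul_last_head]
  | cons f x a, last g, h => by simp [length] at h
  | cons f x a, cons g y b, h => by
    simp only [cons_mul, IsPrefix, head_mul_last_head]
    rw [isPrefix_mul_last_head_iff v (Nat.le_of_succ_le_succ h)]

/-- Induction on `q`: a meet gives a conjunction. For `op x e`, primeness leaves a condition
independent of `h`, or else a condition on what follows: a bound on `h`, or the same question for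
`e` and the tail of `m`. -/
theorem emptyOrPrincipal_head_mul_le (q : Proj X) :
    ∀ m : Chain X, EmptyOrPrincipal fun h => (m.mul (last h)).head ≤ q := by
  induction q using Proj.induction with
  | top => exact fun m => Or.inr ⟨⊤, fun h => by simp⟩
  | inf e f he hf =>
    intro m
    simpa only [le_inf_iff] using (he m).and (hf m)
  | op x e he =>
    rintro (f | ⟨f, y, m⟩)
    · simpa only [last_mul, head_scale, head_last, inf_le_op_iff] using
        EmptyOrPrincipal.const_or (f ≤ op x e) (Or.inr ⟨op x e, fun h => Iff.rfl⟩)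
    · simpa only [cons_mul, head_cons, inf_le_op_iff, op_le_op_iff] using
        ((he m).const_and (y = x)).const_or (f ≤ op x e)

theorem emptyOrPrincipal_isPrefix_mul :
    ∀ a b : Chain X, EmptyOrPrincipal fun h => IsPrefix a (b.mul (last h))
  | last f, b => emptyOrPrincipal_head_mul_le f b
  | cons f x a, last g => Or.inl fun h h' => h'
  | cons f x a, cons g y b => by
    by_cases hxy : x = y
    · subst hxy
      have h₁ := emptyOrPrincipal_head_mul_le f (cons g x b)
      have h₂ := emptyOrPrincipal_head_mul_le g (cons f x b)
      have h₃ := emptyOrPrincipal_isPrefix_mul a b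
      -- The equation between heads becomes two inequalities of the kind already treated, for the
      -- chains in `h₁` and `h₂`.
      have key : ∀ c : Proj X, g ⊓ c = f ⊓ c ↔ g ⊓ c ≤ f ∧ f ⊓ c ≤ g := fun c =>
        ⟨fun h => ⟨h.le.trans inf_le_left, h.ge.trans inf_le_left⟩, fun h =>
          le_antisymm (le_inf h.1 inf_le_right) (le_inf h.2 inf_le_right)⟩
      simpa only [cons_mul, IsPrefix, head_cons, key, true_and] using (h₁.and h₂).and h₃
    · exact Or.inl fun h hp => hxy hp.1.1

/-- If `u a = v b` and `a` is not longer than `b`, then `a` divides `b` on the right, or `a` and `b`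
differ only in their heads. -/
theorem right_factor_or_of_mul_eq {a b : Chain X} (hb : b.IsNormal) (hab : a.length ≤ b.length) :
    ∀ {u v : Chain X}, u.IsNormal → u.mul a = v.mul b → (∃ w : Chain X, w.IsNormal ∧ b = w.mul a) ∨
      (scale b.head a = scale a.head b ∧ u.mul (scale b.head a) = u.mul a)
  | last f, last g, _, h => by
    have h' : f ⊓ a.head = g ⊓ b.head := by simpa using congrArg head h
    refine Or.inr ⟨?_, ?_⟩
    · cases a <;> cases b <;> simp_all [inf_comm]
    · rw [last_mul, last_mul, scale_scale, inf_comm, ← scale_scale, scale_of_head_le]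
      rw [head_scale, h']
      exact inf_le_right
  | last f, cons g y v, _, h => by
    have := congrArg length h
    simp [length] at this
    omega
  | cons f x u, last g, hu, h => by
    left
    cases b with
    | last k => simp at h
    | cons k y b =>
      simp only [cons_mul, last_mul, scale_cons, cons.injEq] at h
      obtain ⟨-, rfl, rfl⟩ := h
      -- The quotient takes its head from `b`; normality of `b` ensures that the product leaves this
      -- head unchanged.
      exact ⟨cons k x u, ⟨hb.1.trans (op_mono x (head_mul_le u a)), hu.2⟩, by
        rw [cons_mul, inf_eq_left.2 hb.1]⟩
  | cons f x u, cons g y v, hu, h => by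
    simp only [cons_mul, cons.injEq] at h
    refine (right_factor_or_of_mul_eq hb hab hu.2 h.2.2).imp_right fun h' => ⟨h'.1, ?_⟩
    rw [cons_mul, cons_mul, h'.2]

end Chain

namespace NormalChain

open Chain

variable {X : Type u}

theorem principalAnnihilators_left :
    PrincipalAnnihilators (NormalChain X) (NormalChain X) := fun a =>
  ⟨ofProj a.1.head, Subtype.ext (scale_of_head_le le_rfl), fun _ _ h =>
    Subtype.ext (mul_last_head_eq (congrArg Subtype.val h))⟩

theorem principalAnnihilators_right :
    PrincipalAnnihilators (NormalChain X)ᵐᵒᵖ (NormalChain X) := fun a =>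
  ⟨.op (ofProj a.1.final), Subtype.ext (mul_last_of_final_le a.2 le_rfl), fun _ _ h =>
    MulOpposite.unop_injective (Subtype.ext (last_final_mul_eq (congrArg Subtype.val h)))⟩

end NormalChain

/-- It suffices to check the condition on intersections for pairs ordered by some length. -/
theorem principalIntersections_of_length_le {R : Type u} {A : Type v} [Monoid R] [MulAction R A]
    (l : A → ℕ) (H : ∀ a b : A, l a ≤ l b → (∃ u v : R, u • a = v • b) →
      ∃ p q : R, p • a = q • b ∧ ∀ u v : R, u • a = v • b → ∃ t : R, u • a = t • p • a) :
    PrincipalIntersections R A := by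
  intro a b h
  rcases le_total (l a) (l b) with hl | hl
  · exact H a b hl h
  · obtain ⟨p, q, hpq, h'⟩ := H b a hl (by obtain ⟨u, v, h⟩ := h; exact ⟨v, u, h.symm⟩)
    refine ⟨q, p, hpq.symm, fun u v huv => ?_⟩
    obtain ⟨t, ht⟩ := h' v u huv.symm
    exact ⟨t, by rw [huv, ht, hpq]⟩

namespace NormalChain

open Chain

variable {X : Type u}

theorem principalIntersections_left :
    PrincipalIntersections (NormalChain X) (NormalChain X) := by
  refine principalIntersections_of_length_le (fun a => a.1.length) ?_
  rintro a b hab ⟨u₀, v₀, h₀⟩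
  by_cases hw : ∃ w : NormalChain X, b = w * a
  · obtain ⟨w, rfl⟩ := hw
    exact ⟨w, 1, (one_mul _).symm, fun u v h => ⟨v, h⟩⟩
  -- Here `b` is not a left multiple of `a`, so b⁺a = a⁺b is a common multiple, and ua = u(b⁺a) for
  -- every solution.
  · have key : ∀ u v : NormalChain X, u • a = v • b → ofProj b.1.head * a = ofProj a.1.head * b ∧
        u * (ofProj b.1.head * a) = u * a := fun u v h => by
      rcases right_factor_or_of_mul_eq b.2 hab u.2 (congrArg Subtype.val h) with ⟨w, h', h⟩ | h
      · exact (hw ⟨⟨w, h'⟩, Subtype.ext h⟩).elim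
      · exact ⟨Subtype.ext h.1, Subtype.ext h.2⟩
    exact ⟨ofProj b.1.head, ofProj a.1.head, (key _ _ h₀).1, fun u v h => ⟨u, (key u v h).2.symm⟩⟩

theorem principalIntersections_right :
    PrincipalIntersections (NormalChain X)ᵐᵒᵖ (NormalChain X) := by
  refine principalIntersections_of_length_le (fun a => a.1.length) ?_
  rintro a b hab ⟨u₀, v₀, h₀⟩
  have key : ∀ u v : NormalChain X, a * u = b * v → IsPrefix a.1 (b.1.mul (last v.1.head)) :=
    fun u v h => (isPrefix_mul_last_head_iff v.1 hab).2 <| by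
      have := isPrefix_mul a.1 u.1
      rwa [← val_mul, h] at this
  obtain h | ⟨q, hq⟩ := emptyOrPrincipal_isPrefix_mul a.1 b.1
  · exact (h _ (key _ _ h₀)).elim
  obtain ⟨p, hp, hpq⟩ := ((hq q).2 le_rfl).exists_mul_eq (IsNormal.mul b.1 (n := last q) trivial)
  have hpq' : a * ⟨p, hp⟩ = b * ofProj q := Subtype.ext hpq
  refine ⟨.op ⟨p, hp⟩, .op (ofProj q), hpq', fun u v h => ⟨v, ?_⟩⟩
  -- Every solution has v⁺ ≤ q, hence bv = (bq)v.
  have hv : ofProj q * v.unop = v.unop := Subtype.ext (scale_of_head_le ((hq _).1 (key _ _ h)))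
  rw [h]
  change b * v.unop = a * ⟨p, hp⟩ * v.unop
  rw [hpq', _root_.mul_assoc, hv]

end NormalChain

/-! ### Transport of the two principal conditions along isomorphisms -/

section Transport

variable {R R' A A' : Type*} [Monoid R] [Monoid R'] [MulAction R A] [MulAction R' A']

theorem PrincipalAnnihilators.of_equiv (e : R ≃* R') (f : A ≃ A')
    (hf : ∀ (r : R) (a : A), f (r • a) = e r • f a) (h : PrincipalAnnihilators R' A') :
    PrincipalAnnihilators R A := by
  intro a
  obtain ⟨k, hk, hk'⟩ := h (f a)
  refine ⟨e.symm k, f.injective (by simp [hf, hk]), fun u v huv => e.injective ?_⟩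
  simpa using hk' (e u) (e v) (by rw [← hf, ← hf, huv])

theorem PrincipalIntersections.of_equiv (e : R ≃* R') (f : A ≃ A')
    (hf : ∀ (r : R) (a : A), f (r • a) = e r • f a) (h : PrincipalIntersections R' A') :
    PrincipalIntersections R A := by
  rintro a b ⟨u₀, v₀, h₀⟩
  obtain ⟨p, q, hpq, h'⟩ := h (f a) (f b) ⟨e u₀, e v₀, by rw [← hf, ← hf, h₀]⟩
  refine ⟨e.symm p, e.symm q, f.injective (by simp [hf, hpq]), fun u v huv => ?_⟩
  obtain ⟨t, ht⟩ := h' (e u) (e v) (by rw [← hf, ← hf, huv])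
  exact ⟨e.symm t, f.injective (by simp [hf, ht])⟩

end Transport

theorem theorem6p1 (X : Type*) :
    WeaklyLeftCoherent (FLAd X) ∧ WeaklyRightCoherent (FLAd X) := by
  obtain ⟨e⟩ := NormalChain.exists_mulEquiv X
  have hl : ∀ r a : FLAd X, e (r • a) = e r • e a := map_mul e
  have hr : ∀ (r : (FLAd X)ᵐᵒᵖ) (a : FLAd X), e (r • a) = MulEquiv.op e r • e a :=
    fun r a => map_mul e a r.unop
  exact ⟨finitelyPresentedAct_of_principal
      (NormalChain.principalAnnihilators_left.of_equiv e e.toEquiv hl)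
      (NormalChain.principalIntersections_left.of_equiv e e.toEquiv hl),
    finitelyPresentedAct_of_principal
      (NormalChain.principalAnnihilators_right.of_equiv (MulEquiv.op e) e.toEquiv hr)
      (NormalChain.principalIntersections_right.of_equiv (MulEquiv.op e) e.toEquiv hr)⟩
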